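/- Let $U_0=[0,1]^2$ with the taxicab metric $d((x,y),(x_1,y_1))=|x-x_1|+|y-y_1|$, and let $M_0$ be its boundary. A \emph{square metric space} is a metric space $X$ with all distances at most $2$, together with an injective map $S_X\colon M_0\to X$ such that $d_X(S_X(i,r),S_X(i,s))=d_X(S_X(r,i),S_X(s,i))=|r-s|$ for $i\in\{0,1\}$ and $r,s\in[0,1]$, and $d_X(S_X(r,s),S_X(t,u))\ge |r-t|+|s-u|$ for all $(r,s),(t,u)\in M_0$. Let $\mathsf{SquaMS}$ be the category of square metric spaces, whose morphisms $f\colon X\to Y$ are the short maps ($d_Y(f(x),f(y))\le d_X(x,y)$) with $f\circ S_X=S_Y$. Let $N=\{0,1,2\}^2$ (cells of the $3\times3$ grid, given as (column, row)) and $M=N\setminus\{(1,1)\}$. For $P\in\{M,N\}$ let $P\otimes X$ be the quotient of $P\times X$ by the equivalence relation generated by $$((i,j),S_X(1,r))\sim((i+1,j),S_X(0,r)),\qquad ((i,j),S_X(r,1))\sim((i,j+1),S_X(r,0))$$ for $r\in[0,1]$ and all pairs of adjacent cells in $P$; write $m\otimes x$ for the class of $(m,x)$. The distance of two points of $P\otimes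 X$ is the infimum of the scores of finite paths in $P\times X$ between representatives, where a step between two identified points scores $0$, any other step from $(m,x)$ to $(m,y)$ scores $\frac13 d_X(x,y)$, and any other step between different copies scores $2$. With this metric and the boundary map $$S_{M\otimes X}(r,s)=(i,j)\otimes S_X(3r-i,3s-j)\quad\text{whenever } (i,j)\in M \text{ and } (3r-i,3s-j)\in M_0,$$ $M\otimes X$ is a square metric space, and $M\otimes-$, with $(M\otimes f)(m\otimes x)=m\otimes f(x)$, is an endofunctor of $\mathsf{SquaMS}$. Let $\alpha_N\colon N\otimes U_0\to U_0$ be the map $(i,j)\otimes z\mapsto(\frac i3,\frac j3)+\frac13 z$. The Sierpinski carpet $\mathbb S$ is the unique non-empty compact subset of $U_0$ with $\mathbb S=\bigcup_{(i,j)\in M}\big((\frac i3,\frac j3)+\frac13\mathbb S\big)$; with the taxicab metric and the inclusion $M_0\subseteq\mathbb S$ it is a square metric space. Let $\tau\colon M\otimes\mathbb S\to\mathbb S$, $(i,j)\otimes s\mapsto(\frac i3,\frac j3)+\frac13 s$, be the restriction of $\alpha_N$; it is a morphism of $\mathsf{SquaMS}$. \textbf{Theorem.} $(\mathbb S,\tau)$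 is a corecursive algebra for $M\otimes-\colon\mathsf{SquaMS}\to\mathsf{SquaMS}$. That is, for every coalgebra $\beta\colon B\to M\otimes B$ in $\mathsf{SquaMS}$ there is exactly one morphism $\beta^*\colon B\to\mathbb S$ of $\mathsf{SquaMS}$ with $\beta^*=\tau\circ(M\otimes\beta^*)\circ\beta$. Moreover, $\tau$ is a bijection, but its inverse $\tau^{-1}\colon\mathbb S\to M\otimes\mathbb S$ is not a short map. -/

import Mathlib

universe u

namespace Sierpinski

open CategoryTheory

/-! ### The unit square with the taxicab metric -/

/-- The plane with the taxicab metric, see `dist_plane`. -/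
abbrev Plane : Type := WithLp 1 (ℝ × ℝ)

theorem dist_plane (p q : Plane) : dist p q = |p.fst - q.fst| + |p.snd - q.snd| := by
  rw [WithLp.prod_dist_eq_add (by norm_num)]
  simp [Real.dist_eq]

theorem plane_ext {p q : Plane} (h1 : p.fst = q.fst) (h2 : p.snd = q.snd) : p = q :=
  WithLp.ofLp_injective 1 (Prod.ext h1 h2)

/-- The unit square `U₀ = [0,1]²`. -/
def unitSquare : Set Plane :=
  {p | 0 ≤ p.fst ∧ p.fst ≤ 1 ∧ 0 ≤ p.snd ∧ p.snd ≤ 1}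

/-- The boundary `M₀` of the unit square. -/
def boundary : Set Plane :=
  {p | p ∈ unitSquare ∧ (p.fst = 0 ∨ p.fst = 1 ∨ p.snd = 0 ∨ p.snd = 1)}

/-! ### The category of square metric spaces -/

/-- A square metric space: a metric space with all distances at most `2`, with an injective map `S`
from the boundary of the unit square. Along each of the four sides distances agree with those
of the unit interval; in general they are at least the taxicab distance. -/
structure SquaMS : Type (u + 1) where
  carrier : Type u
  [metric : MetricSpace carrier]
  S : boundary → carrier
  S_injective : Function.Injective S
  dist_le_two : ∀ x y : carrier, dist x y ≤ 2
  sq1_vertical : ∀ p q : boundary, p.1.fst = q.1.fst → (p.1.fst = 0 ∨ p.1.fst = 1) →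
    dist (S p) (S q) = |q.1.snd - p.1.snd|
  sq1_horizontal : ∀ p q : boundary, p.1.snd = q.1.snd → (p.1.snd = 0 ∨ p.1.snd = 1) →
    dist (S p) (S q) = |q.1.fst - p.1.fst|
  sq2 : ∀ p q : boundary, |p.1.fst - q.1.fst| + |p.1.snd - q.1.snd| ≤ dist (S p) (S q)

instance : CoeSort SquaMS.{u} (Type u) := ⟨SquaMS.carrier⟩

attribute [instance] SquaMS.metric

/-- Morphisms of square metric spaces: short maps that preserve `S`. -/
@[ext]
structure SquaMS.Hom (X Y : SquaMS.{u}) : Type u where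
  toFun : X → Y
  short : ∀ x y : X, dist (toFun x) (toFun y) ≤ dist x y
  map_S : ∀ p : boundary, toFun (X.S p) = Y.S p

instance : Category SquaMS.{u} where
  Hom := SquaMS.Hom
  id X := ⟨fun x => x, fun _ _ => le_rfl, fun _ => rfl⟩
  comp f g := ⟨fun x => g.toFun (f.toFun x),
    fun x y => (g.short _ _).trans (f.short x y),
    fun p => by rw [f.map_S, g.map_S]⟩

/-! ### Gluing nine (or eight) copies of a square metric space -/

/-- Positions (column, row) in the `3 × 3` grid. -/
abbrev Cell : Type := Fin 3 × Fin 3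

/-- The set `M` of all cells but the central one. -/
def M : Set Cell := {m | m ≠ (1, 1)}

/-- The set `N` of all nine cells. -/
def N : Set Cell := Set.univ

/-- The generating gluing relation: the right side of a cell is glued to the left side of the
cell on its right, and the top side of a cell is glued to the bottom side of the cell above it. -/
def Glued (m n : Cell) (p q : boundary) : Prop :=
  (n.1.val = m.1.val + 1 ∧ n.2 = m.2 ∧ p.1.fst = 1 ∧ q.1.fst = 0 ∧ p.1.snd = q.1.snd) ∨
  (n.1 = m.1 ∧ n.2.val = m.2.val + 1 ∧ p.1.snd = 1 ∧ q.1.snd = 0 ∧ p.1.fst = q.1.fst)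

/-- The relation `Glued`, transported to `P × X` along `S`. -/
def GlueRel (P : Set Cell) (X : SquaMS.{u}) (a b : P × X) : Prop :=
  ∃ p q : boundary, a.2 = X.S p ∧ b.2 = X.S q ∧ Glued a.1.1 b.1.1 p q

/-- The underlying set of `P ⊗ X`: the quotient of `P × X` by the equivalence relation generated by
`GlueRel`. -/
def Tensor (P : Set Cell) (X : SquaMS.{u}) : Type u := Quot (GlueRel P X)

/-- The element `m ⊗ x`, for a pair `(m, x)`. -/
def Tensor.mk {P : Set Cell} {X : SquaMS.{u}} (a : P × X) : Tensor P X := Quot.mk _ a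

section metric

variable {P : Set Cell} {X : SquaMS.{u}}

open Classical in
/-- The contribution of one step of a path in `P × X`: zero between identified points, and
otherwise `1/3` of the distance within one copy of `X`, and `2` between different copies. -/
noncomputable def stepScore (a b : P × X) : ℝ :=
  if Tensor.mk a = Tensor.mk b then 0 else if a.1 = b.1 then 1 / 3 * dist a.2 b.2 else 2

/-- The score of the path from `a` to `b` with the given list of intermediate points. -/
noncomputable def pathScore : P × X → List (P × X) → P × X → ℝ
  | a, [], b => stepScore a b
  | a, c :: l, b => stepScore a c + pathScore c l b

/-- The infimum of the scores of all finite paths from `a` to `b`. -/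
noncomputable def pathDist (a b : P × X) : ℝ := ⨅ l : List (P × X), pathScore a l b

theorem stepScore_eq_zero {a b : P × X} (h : Tensor.mk a = Tensor.mk b) : stepScore a b = 0 := by
  simp [stepScore, h]

theorem stepScore_nonneg (a b : P × X) : 0 ≤ stepScore a b := by
  unfold stepScore; split_ifs <;> positivity

theorem stepScore_comm (a b : P × X) : stepScore a b = stepScore b a := by
  by_cases h : Tensor.mk a = Tensor.mk b
  · rw [stepScore_eq_zero h, stepScore_eq_zero h.symm]
  · by_cases h' : a.1 = b.1
    · simp [stepScore, h, Ne.symm h, h', dist_comm]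
    · simp [stepScore, h, Ne.symm h, h', Ne.symm h']

theorem stepScore_le (m : P) (x y : X) : stepScore (m, x) (m, y) ≤ 1 / 3 * dist x y := by
  unfold stepScore; split_ifs with h1 h2
  · positivity
  · exact le_rfl
  · exact absurd rfl h2

theorem stepScore_le_two (a b : P × X) : stepScore a b ≤ 2 := by
  have := X.dist_le_two a.2 b.2
  unfold stepScore; split_ifs <;> linarith

theorem pathScore_nonneg (a b : P × X) (l : List (P × X)) : 0 ≤ pathScore a l b := by
  induction l generalizing a with
  | nil => exact stepScore_nonneg a b
  | cons c l ih => exact add_nonneg (stepScore_nonneg a c) (ih c)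

theorem pathScore_append (a b c : P × X) (l l' : List (P × X)) :
    pathScore a (l ++ c :: l') b = pathScore a l c + pathScore c l' b := by
  induction l generalizing a with
  | nil => rfl
  | cons d l ih => simp only [List.cons_append, pathScore, ih]; ring

theorem pathScore_reverse (a b : P × X) (l : List (P × X)) :
    pathScore b l.reverse a = pathScore a l b := by
  induction l generalizing a with
  | nil => exact stepScore_comm b a
  | cons c l ih =>
    rw [List.reverse_cons, pathScore_append, ih]
    simp only [pathScore]
    rw [stepScore_comm c a, add_comm]

theorem bddBelow_pathScore (a b : P × X) :
    BddBelow (Set.range fun l : List (P × X) => pathScore a l b) :=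
  ⟨0, by rintro _ ⟨l, rfl⟩; exact pathScore_nonneg a b l⟩

theorem pathDist_le (a b : P × X) (l : List (P × X)) : pathDist a b ≤ pathScore a l b :=
  ciInf_le (bddBelow_pathScore a b) l

theorem pathDist_le_step (a b : P × X) : pathDist a b ≤ stepScore a b := pathDist_le a b []

theorem pathDist_nonneg (a b : P × X) : 0 ≤ pathDist a b :=
  le_ciInf (pathScore_nonneg a b)

theorem pathDist_comm (a b : P × X) : pathDist a b = pathDist b a := by
  have key : ∀ a b : P × X, pathDist a b ≤ pathDist b a := fun a b =>
    le_ciInf fun l => by rw [← pathScore_reverse]; exact pathDist_le _ _ _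
  exact le_antisymm (key a b) (key b a)

theorem pathDist_triangle (a b c : P × X) : pathDist a c ≤ pathDist a b + pathDist b c :=
  le_ciInf_add_ciInf fun l l' => by rw [← pathScore_append]; exact pathDist_le _ _ _

theorem pathDist_eq_zero {a b : P × X} (h : Tensor.mk a = Tensor.mk b) : pathDist a b = 0 :=
  le_antisymm ((pathDist_le_step a b).trans_eq (stepScore_eq_zero h)) (pathDist_nonneg a b)

theorem pathDist_congr {a a' : P × X} (h : Tensor.mk a = Tensor.mk a') (b : P × X) :
    pathDist a b = pathDist a' b := by
  have h1 := pathDist_triangle a a' b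
  have h2 := pathDist_triangle a' a b
  rw [pathDist_eq_zero h] at h1
  rw [pathDist_eq_zero h.symm] at h2
  linarith

/-- A map to a metric space that does not expand any step does not expand the path distance. -/
theorem dist_le_pathDist {Y : Type*} [PseudoMetricSpace Y] (f : P × X → Y)
    (hf : ∀ a b, dist (f a) (f b) ≤ stepScore a b) (a b : P × X) :
    dist (f a) (f b) ≤ pathDist a b := by
  refine le_ciInf fun l => ?_
  induction l generalizing a with
  | nil => exact hf a b
  | cons c l ih => exact (dist_triangle _ (f c) _).trans (add_le_add (hf a c) (ih c))

/-- The quotient metric on `P ⊗ X`: the infimum of the scores of all paths. -/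
noncomputable instance : PseudoMetricSpace (Tensor P X) where
  dist := Quot.lift (fun a => Quot.lift (fun b => pathDist a b)
      (fun b b' h => by
        rw [pathDist_comm a b, pathDist_comm a b']; exact pathDist_congr (Quot.sound h) a))
    (fun a a' h => by
      funext t; induction t using Quot.ind with
      | mk b => exact pathDist_congr (Quot.sound h) b)
  dist_self t := by
    induction t using Quot.ind with
    | mk a => exact pathDist_eq_zero rfl
  dist_comm s t := by
    induction s using Quot.ind with
    | mk a => induction t using Quot.ind with
      | mk b => exact pathDist_comm a b
  dist_triangle s t v := by
    induction s using Quot.ind with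
    | mk a => induction t using Quot.ind with
      | mk b => induction v using Quot.ind with
        | mk c => exact pathDist_triangle a b c

theorem dist_mk (a b : P × X) : dist (Tensor.mk a) (Tensor.mk b) = pathDist a b := rfl

theorem dist_tensor_le_two (s t : Tensor P X) : dist s t ≤ 2 := by
  induction s using Quot.ind with
  | mk a => induction t using Quot.ind with
    | mk b => exact (pathDist_le_step a b).trans (stepScore_le_two a b)

theorem dist_mk_le (m : P) (x y : X) :
    dist (Tensor.mk (m, x)) (Tensor.mk (m, y)) ≤ 1 / 3 * dist x y :=
  (pathDist_le_step _ _).trans (stepScore_le m x y)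

/-- A real function on `P × X` which respects the gluing, is `1/3`-Lipschitz on each copy of `X` and
has oscillation at most `2`, bounds the distance from below. -/
theorem abs_sub_le_pathDist (F : P × X → ℝ) (h1 : ∀ a b, GlueRel P X a b → F a = F b)
    (h2 : ∀ m x y, |F (m, x) - F (m, y)| ≤ 1 / 3 * dist x y)
    (h3 : ∀ a b, |F a - F b| ≤ 2) (a b : P × X) : |F a - F b| ≤ pathDist a b := by
  rw [← Real.dist_eq]
  refine dist_le_pathDist F (fun a b => ?_) a b
  rw [Real.dist_eq]
  unfold stepScore
  split_ifs with h h'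
  · have : F a = F b := congrArg (Quot.lift F h1) h
    simp [this]
  · obtain ⟨m, x⟩ := a
    obtain ⟨n, y⟩ := b
    obtain rfl : m = n := h'
    exact h2 m x y
  · exact h3 a b

end metric

/-! ### The coordinates of `P ⊗ X` -/

section coordinates

/-- The point `shrink (i, j) = (i/3, j/3)`. -/
noncomputable def shrink (m : Cell) : Plane := WithLp.toLp 1 ((m.1.val : ℝ) / 3, (m.2.val : ℝ) / 3)

/-- The contraction `σ_m` of the plane, `p ↦ shrink m + p / 3`. -/
noncomputable def contraction (m : Cell) (p : Plane) : Plane := shrink m + (1 / 3 : ℝ) • p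

theorem contraction_fst (m : Cell) (p : Plane) :
    (contraction m p).fst = (m.1.val + p.fst) / 3 := by
  simp [contraction, shrink]; ring

theorem contraction_snd (m : Cell) (p : Plane) :
    (contraction m p).snd = (m.2.val + p.snd) / 3 := by
  simp [contraction, shrink]; ring

theorem contraction_eq_of_glued {m n : Cell} {p q : boundary} (h : Glued m n p q) :
    contraction m p = contraction n q := by
  obtain ⟨h1, h2, h3, h4, h5⟩ | ⟨h1, h2, h3, h4, h5⟩ := h
  · apply plane_ext
    · rw [contraction_fst, contraction_fst, h1, h3, h4]; push_cast; ring
    · rw [contraction_snd, contraction_snd, h2, h5]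
  · apply plane_ext
    · rw [contraction_fst, contraction_fst, h1, h5]
    · rw [contraction_snd, contraction_snd, h2, h3, h4]; push_cast; ring

theorem contraction_injective (m : Cell) : Function.Injective (contraction m) := by
  intro p q h
  have h1 := congrArg WithLp.fst h
  have h2 := congrArg WithLp.snd h
  rw [contraction_fst, contraction_fst] at h1
  rw [contraction_snd, contraction_snd] at h2
  apply plane_ext <;> linarith

theorem dist_contraction (m : Cell) (p q : Plane) :
    dist (contraction m p) (contraction m q) = 1 / 3 * dist p q := by
  simp [contraction, dist_smul₀]

theorem cell_le_two (i : Fin 3) : (i.val : ℝ) ≤ 2 := by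
  have := i.isLt
  exact_mod_cast (by omega : i.val ≤ 2)

theorem contraction_mem (m : Cell) {p : Plane} (hp : p ∈ unitSquare) :
    contraction m p ∈ unitSquare := by
  obtain ⟨h1, h2, h3, h4⟩ := hp
  have hi := cell_le_two m.1
  have hj := cell_le_two m.2
  have hi0 : (0 : ℝ) ≤ m.1.val := by positivity
  have hj0 : (0 : ℝ) ≤ m.2.val := by positivity
  refine ⟨?_, ?_, ?_, ?_⟩ <;> simp only [contraction_fst, contraction_snd] <;> linarith

/-- The function `(r, s) ↦ r ± s` on the boundary extends to a short function on `X` with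
the same bounds. -/
theorem exists_short_extension (X : SquaMS.{u}) (e c : ℝ)
    (he : (e = 1 ∧ c = 0) ∨ (e = -1 ∧ c = -1)) :
    ∃ f : X → ℝ, (∀ x y, |f x - f y| ≤ dist x y) ∧
      (∀ p : boundary, f (X.S p) = p.1.fst + e * p.1.snd) ∧ ∀ x, c ≤ f x ∧ f x ≤ c + 2 := by
  set g : X → ℝ := Function.extend X.S (fun p => p.1.fst + e * p.1.snd) 0 with hg
  have hgS : ∀ p, g (X.S p) = p.1.fst + e * p.1.snd := fun p => X.S_injective.extend_apply _ _ _
  have hlip : LipschitzOnWith 1 g (Set.range X.S) := by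
    apply LipschitzOnWith.of_dist_le_mul
    rintro _ ⟨p, rfl⟩ _ ⟨q, rfl⟩
    rw [hgS, hgS, Real.dist_eq, NNReal.coe_one, one_mul]
    refine le_trans ?_ (X.sq2 p q)
    rcases he with ⟨rfl, -⟩ | ⟨rfl, -⟩
    · calc _ = |(p.1.fst - q.1.fst) + (p.1.snd - q.1.snd)| := by congr 1; ring
        _ ≤ _ := abs_add_le _ _
    · calc _ = |(p.1.fst - q.1.fst) - (p.1.snd - q.1.snd)| := by congr 1; ring
        _ ≤ _ := abs_sub _ _
  obtain ⟨k, hk, hkg⟩ := hlip.extend_real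
  refine ⟨fun x => max c (min (c + 2) (k x)), fun x y => ?_, fun p => ?_, fun x => ?_⟩
  · have h := hk.dist_le_mul x y
    rw [Real.dist_eq, NNReal.coe_one, one_mul] at h
    refine le_trans ?_ h
    refine (abs_max_sub_max_le_max _ _ _ _).trans ?_
    refine max_le (by simp) ?_
    refine (abs_min_sub_min_le_max _ _ _ _).trans ?_
    exact max_le (by simp) le_rfl
  · have h : k (X.S p) = p.1.fst + e * p.1.snd := by rw [← hkg ⟨p, rfl⟩, hgS]
    obtain ⟨h1, h2, h3, h4⟩ := p.2.1
    simp only [h]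
    rw [min_eq_right, max_eq_right] <;> rcases he with ⟨rfl, rfl⟩ | ⟨rfl, rfl⟩ <;> linarith
  · exact ⟨le_max_left _ _, max_le (by linarith) (min_le_left _ _)⟩

variable {P : Set Cell} {X : SquaMS.{u}}

theorem abs_combination_le (e c : ℝ) (he : (e = 1 ∧ c = 0) ∨ (e = -1 ∧ c = -1))
    (m n : P) (p q : boundary) :
    |((contraction m p).fst + e * (contraction m p).snd) -
      ((contraction n q).fst + e * (contraction n q).snd)| ≤
      pathDist (X := X) (m, X.S p) (n, X.S q) := by
  obtain ⟨f, hf1, hf2, hf3⟩ := exists_short_extension X e c he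
  have key := abs_sub_le_pathDist (P := P) (X := X)
    (fun a => (a.1.1.1.val + e * a.1.1.2.val + f a.2) / 3) ?_ ?_ ?_ (m, X.S p) (n, X.S q)
  · refine le_trans (le_of_eq ?_) key
    simp only [contraction_fst, contraction_snd, hf2]
    congr 1; ring
  · rintro ⟨m, x⟩ ⟨n, y⟩ ⟨p, q, rfl, rfl, h⟩
    have h1 := congrArg WithLp.fst (contraction_eq_of_glued h)
    have h2 := congrArg WithLp.snd (contraction_eq_of_glued h)
    simp only [contraction_fst, contraction_snd] at h1 h2
    simp only [hf2]
    linear_combination h1 + e * h2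
  · intro m x y
    have := hf1 x y
    rw [abs_le] at this ⊢
    constructor <;> linarith [this.1, this.2]
  · rintro ⟨m, x⟩ ⟨n, y⟩
    have a1 := cell_le_two m.1.1
    have a2 := cell_le_two m.1.2
    have a3 := cell_le_two n.1.1
    have a4 := cell_le_two n.1.2
    have b1 : (0 : ℝ) ≤ m.1.1.val := by positivity
    have b2 : (0 : ℝ) ≤ m.1.2.val := by positivity
    have b3 : (0 : ℝ) ≤ n.1.1.val := by positivity
    have b4 : (0 : ℝ) ≤ n.1.2.val := by positivity
    have := hf3 x
    have := hf3 y
    rw [abs_le]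
    rcases he with ⟨rfl, rfl⟩ | ⟨rfl, rfl⟩ <;> constructor <;> linarith

/-- Distances between boundary points of copies of `X` are bounded below by the taxicab distance. -/
theorem dist_contraction_le (m n : P) (p q : boundary) :
    dist (contraction m p) (contraction n q) ≤ pathDist (X := X) (m, X.S p) (n, X.S q) := by
  have h1 := abs_combination_le (X := X) 1 0 (Or.inl ⟨rfl, rfl⟩) m n p q
  have h2 := abs_combination_le (X := X) (-1) (-1) (Or.inr ⟨rfl, rfl⟩) m n p q
  rw [dist_plane]
  rw [abs_le] at h1 h2
  rcases abs_cases ((contraction m p).fst - (contraction n q).fst) with ⟨h, -⟩ | ⟨h, -⟩ <;>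
  rcases abs_cases ((contraction m p).snd - (contraction n q).snd) with ⟨h', -⟩ | ⟨h', -⟩ <;>
  rw [h, h'] <;> linarith [h1.1, h1.2, h2.1, h2.2]

end coordinates

/-! ### `M ⊗ X` is a metric space -/

section separation

variable {X : SquaMS.{u}}

theorem mk_eq_of_glued {P : Set Cell} {m n : P} {p q : boundary} (h : Glued m n p q) :
    Tensor.mk (X := X) (m, X.S p) = Tensor.mk (n, X.S q) :=
  Quot.sound ⟨p, q, rfl, rfl, h⟩

theorem corner_mem {a b : ℝ} (ha : a = 0 ∨ a = 1) (hb : b = 0 ∨ b = 1) :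
    (WithLp.toLp 1 (a, b) : Plane) ∈ boundary := by
  refine ⟨?_, ?_⟩
  · rcases ha with rfl | rfl <;> rcases hb with rfl | rfl <;> simp [unitSquare]
  · rcases ha with rfl | rfl <;> simp

theorem mk_eq_of_contraction_eq_aux (m n : M) (p q : boundary)
    (h : contraction m p = contraction n q)
    (hmn : n.1.1.val = m.1.1.val + 1 ∨ (n.1.1 = m.1.1 ∧ n.1.2.val = m.1.2.val + 1)) :
    Tensor.mk (X := X) (m, X.S p) = Tensor.mk (n, X.S q) := by
  have h1 := congrArg WithLp.fst h
  have h2 := congrArg WithLp.snd h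
  simp only [contraction_fst, contraction_snd] at h1 h2
  obtain ⟨p1, p2, p3, p4⟩ := p.2.1
  obtain ⟨q1, q2, q3, q4⟩ := q.2.1
  rcases hmn with hc | ⟨hc, hr⟩
  · rw [hc] at h1; push_cast at h1
    have e1 : p.1.fst = 1 := by linarith
    have e2 : q.1.fst = 0 := by linarith
    have b1 : m.1.2.val ≤ n.1.2.val + 1 := by
      have : (m.1.2.val : ℝ) ≤ n.1.2.val + 1 := by linarith
      exact_mod_cast this
    have b2 : n.1.2.val ≤ m.1.2.val + 1 := by
      have : (n.1.2.val : ℝ) ≤ m.1.2.val + 1 := by linarith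
      exact_mod_cast this
    obtain hr | hr | hr : n.1.2.val = m.1.2.val ∨ n.1.2.val = m.1.2.val + 1 ∨
      m.1.2.val = n.1.2.val + 1 := by omega
    · rw [hr] at h2
      exact mk_eq_of_glued (Or.inl ⟨hc, Fin.ext hr, e1, e2, by linarith⟩)
    · rw [hr] at h2; push_cast at h2
      have e3 : p.1.snd = 1 := by linarith
      have e4 : q.1.snd = 0 := by linarith
      by_cases hM : ((n.1.1, m.1.2) : Cell) ∈ M
      · have c := corner_mem (a := 0) (b := 1) (Or.inl rfl) (Or.inr rfl)
        exact (mk_eq_of_glued (m := m) (p := p) (n := ⟨_, hM⟩) (q := ⟨_, c⟩)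
          (Or.inl ⟨hc, rfl, e1, rfl, e3⟩)).trans
          (mk_eq_of_glued (m := ⟨_, hM⟩) (p := ⟨_, c⟩) (n := n) (q := q)
            (Or.inr ⟨rfl, hr, rfl, e4, e2.symm⟩))
      · have hM' : ((m.1.1, n.1.2) : Cell) ∈ M := by
          intro h'
          simp only [M, Set.mem_ofPred_eq, not_not, Prod.mk.injEq] at hM h'
          rw [hM.1, h'.1] at hc; simp at hc
        have c := corner_mem (a := 1) (b := 0) (Or.inr rfl) (Or.inl rfl)
        exact (mk_eq_of_glued (m := m) (p := p) (n := ⟨_, hM'⟩) (q := ⟨_, c⟩)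
          (Or.inr ⟨rfl, hr, e3, rfl, e1⟩)).trans
          (mk_eq_of_glued (m := ⟨_, hM'⟩) (p := ⟨_, c⟩) (n := n) (q := q)
            (Or.inl ⟨hc, rfl, rfl, e2, e4.symm⟩))
    · rw [hr] at h2; push_cast at h2
      have e3 : p.1.snd = 0 := by linarith
      have e4 : q.1.snd = 1 := by linarith
      by_cases hM : ((n.1.1, m.1.2) : Cell) ∈ M
      · have c := corner_mem (a := 0) (b := 0) (Or.inl rfl) (Or.inl rfl)
        exact (mk_eq_of_glued (m := m) (p := p) (n := ⟨_, hM⟩) (q := ⟨_, c⟩)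
          (Or.inl ⟨hc, rfl, e1, rfl, e3⟩)).trans
          (mk_eq_of_glued (m := n) (p := q) (n := ⟨_, hM⟩) (q := ⟨_, c⟩)
            (Or.inr ⟨rfl, hr, e4, rfl, e2⟩)).symm
      · have hM' : ((m.1.1, n.1.2) : Cell) ∈ M := by
          intro h'
          simp only [M, Set.mem_ofPred_eq, not_not, Prod.mk.injEq] at hM h'
          rw [hM.1, h'.1] at hc; simp at hc
        have c := corner_mem (a := 1) (b := 1) (Or.inr rfl) (Or.inr rfl)
        exact (mk_eq_of_glued (m := ⟨_, hM'⟩) (p := ⟨_, c⟩) (n := m) (q := p)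
          (Or.inr ⟨rfl, hr, rfl, e3, e1.symm⟩)).symm.trans
          (mk_eq_of_glued (m := ⟨_, hM'⟩) (p := ⟨_, c⟩) (n := n) (q := q)
            (Or.inl ⟨hc, rfl, rfl, e2, e4.symm⟩))
  · rw [hc] at h1
    rw [hr] at h2; push_cast at h2
    exact mk_eq_of_glued (Or.inr ⟨hc, hr, by linarith, by linarith, by linarith⟩)

/-- Boundary points of copies of `X` which have the same position in the square are identified. -/
theorem mk_eq_of_contraction_eq (m n : M) (p q : boundary)
    (h : contraction m p = contraction n q) :
    Tensor.mk (X := X) (m, X.S p) = Tensor.mk (n, X.S q) := by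
  by_cases hmn : m = n
  · subst hmn
    rw [Subtype.ext (contraction_injective _ h)]
  have h1 := congrArg WithLp.fst h
  have h2 := congrArg WithLp.snd h
  simp only [contraction_fst, contraction_snd] at h1 h2
  obtain ⟨p1, p2, p3, p4⟩ := p.2.1
  obtain ⟨q1, q2, q3, q4⟩ := q.2.1
  have b1 : m.1.1.val ≤ n.1.1.val + 1 := by
    have : (m.1.1.val : ℝ) ≤ n.1.1.val + 1 := by linarith
    exact_mod_cast this
  have b2 : n.1.1.val ≤ m.1.1.val + 1 := by
    have : (n.1.1.val : ℝ) ≤ m.1.1.val + 1 := by linarith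
    exact_mod_cast this
  have b3 : m.1.2.val ≤ n.1.2.val + 1 := by
    have : (m.1.2.val : ℝ) ≤ n.1.2.val + 1 := by linarith
    exact_mod_cast this
  have b4 : n.1.2.val ≤ m.1.2.val + 1 := by
    have : (n.1.2.val : ℝ) ≤ m.1.2.val + 1 := by linarith
    exact_mod_cast this
  have hne : ¬ (m.1.1 = n.1.1 ∧ m.1.2 = n.1.2) := fun h => hmn (Subtype.ext (Prod.ext h.1 h.2))
  simp only [Fin.ext_iff] at hne
  by_cases hd : n.1.1.val = m.1.1.val + 1 ∨ (n.1.1 = m.1.1 ∧ n.1.2.val = m.1.2.val + 1)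
  · exact mk_eq_of_contraction_eq_aux m n p q h hd
  · refine (mk_eq_of_contraction_eq_aux n m q p h.symm ?_).symm
    simp only [Fin.ext_iff] at hd ⊢
    omega

theorem isCompact_unitSquare : IsCompact unitSquare := by
  have : unitSquare = WithLp.toLp 1 '' (Set.Icc (0 : ℝ) 1 ×ˢ Set.Icc (0 : ℝ) 1) := by
    ext p
    constructor
    · rintro ⟨h1, h2, h3, h4⟩
      exact ⟨(p.fst, p.snd), ⟨⟨h1, h2⟩, ⟨h3, h4⟩⟩, rfl⟩
    · rintro ⟨q, ⟨⟨h1, h2⟩, ⟨h3, h4⟩⟩, rfl⟩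
      exact ⟨h1, h2, h3, h4⟩
  rw [this]
  exact (isCompact_Icc.prod isCompact_Icc).image (WithLp.prod_continuous_toLp 1 ℝ ℝ)

theorem continuous_plane_fst : Continuous fun p : Plane => p.fst :=
  continuous_fst.comp (WithLp.prod_continuous_ofLp 1 ℝ ℝ)

theorem continuous_plane_snd : Continuous fun p : Plane => p.snd :=
  continuous_snd.comp (WithLp.prod_continuous_ofLp 1 ℝ ℝ)

theorem isCompact_boundary : IsCompact boundary := by
  have : boundary = unitSquare ∩ {p | p.fst = 0 ∨ p.fst = 1 ∨ p.snd = 0 ∨ p.snd = 1} := rfl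
  rw [this]
  refine isCompact_unitSquare.inter_right ?_
  exact (isClosed_eq continuous_plane_fst continuous_const).union
    ((isClosed_eq continuous_plane_fst continuous_const).union
      ((isClosed_eq continuous_plane_snd continuous_const).union
        (isClosed_eq continuous_plane_snd continuous_const)))

theorem dist_S_le_of_corner (X : SquaMS.{u}) (p q : boundary)
    (hp : p.1.fst = 0 ∨ p.1.fst = 1) (hq : q.1.snd = 0 ∨ q.1.snd = 1) :
    dist (X.S p) (X.S q) ≤ 2 * dist p q := by
  have h1 := X.sq1_vertical p ⟨_, corner_mem hp hq⟩ rfl hp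
  have h2 := X.sq1_horizontal q ⟨_, corner_mem hp hq⟩ rfl hq
  have h3 := dist_triangle_right (X.S p) (X.S q) (X.S ⟨_, corner_mem hp hq⟩)
  rw [h1, h2] at h3
  change _ ≤ |q.1.snd - p.1.snd| + |p.1.fst - q.1.fst| at h3
  rw [abs_sub_comm q.1.snd p.1.snd] at h3
  rw [Subtype.dist_eq, dist_plane]
  have := abs_nonneg (p.1.fst - q.1.fst)
  have := abs_nonneg (p.1.snd - q.1.snd)
  linarith

/-- The map `S` is Lipschitz. -/
theorem dist_S_le (X : SquaMS.{u}) (p q : boundary) :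
    dist (X.S p) (X.S q) ≤ 2 * dist p q := by
  have hd : dist p q = |p.1.fst - q.1.fst| + |p.1.snd - q.1.snd| := dist_plane _ _
  have n1 := abs_nonneg (p.1.fst - q.1.fst)
  have n2 := abs_nonneg (p.1.snd - q.1.snd)
  have hp : (p.1.fst = 0 ∨ p.1.fst = 1) ∨ (p.1.snd = 0 ∨ p.1.snd = 1) := by
    have := p.2.2; tauto
  have hq : (q.1.fst = 0 ∨ q.1.fst = 1) ∨ (q.1.snd = 0 ∨ q.1.snd = 1) := by
    have := q.2.2; tauto
  rcases hp with hp | hp <;> rcases hq with hq | hq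
  · by_cases h : p.1.fst = q.1.fst
    · rw [X.sq1_vertical p q h hp, hd, abs_sub_comm]; linarith
    · have : |p.1.fst - q.1.fst| = 1 := by
        rcases hp with hp | hp <;> rcases hq with hq | hq <;> simp_all
      have := X.dist_le_two (X.S p) (X.S q)
      linarith
  · exact dist_S_le_of_corner X p q hp hq
  · rw [dist_comm, dist_comm p]; exact dist_S_le_of_corner X q p hq hp
  · by_cases h : p.1.snd = q.1.snd
    · rw [X.sq1_horizontal p q h hp, hd, abs_sub_comm]; linarith
    · have : |p.1.snd - q.1.snd| = 1 := by
        rcases hp with hp | hp <;> rcases hq with hq | hq <;> simp_all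
      have := X.dist_le_two (X.S p) (X.S q)
      linarith

theorem isClosed_range_S (X : SquaMS.{u}) : IsClosed (Set.range X.S) := by
  have : CompactSpace boundary := isCompact_iff_compactSpace.1 isCompact_boundary
  have h : LipschitzWith 2 X.S := LipschitzWith.of_dist_le_mul (dist_S_le X)
  exact (isCompact_range h.continuous).isClosed

/-- A point of `M × X` off the boundary of its copy of `X` has positive distance from all other
points. -/
theorem pathDist_pos_of_notMem {P : Set Cell} {a b : P × X} (h : a ≠ b)
    (ha : a.2 ∉ Set.range X.S) : 0 < pathDist a b := by
  classical
  obtain ⟨m, x⟩ := a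
  obtain ⟨n, y⟩ := b
  obtain ⟨δ, hδ, hball⟩ := Metric.isOpen_iff.1 (isClosed_range_S X).isOpen_compl x ha
  set ρ : ℝ := min δ 2
  have hρ : 0 < ρ := lt_min hδ two_pos
  have hS : ∀ p, ρ ≤ dist x (X.S p) := fun p => by
    by_contra hlt
    push Not at hlt
    exact hball (show X.S p ∈ Metric.ball x δ by
      rw [Metric.mem_ball, dist_comm]; exact hlt.trans_le (min_le_left _ _)) ⟨p, rfl⟩
  set F : P × X → ℝ := fun c => if c.1 = m then 1 / 3 * max 0 (ρ - dist x c.2) else 0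
  have hF0 : ∀ c, 0 ≤ F c := fun c => by
    simp only [F]; split_ifs <;> positivity
  have hF2 : ∀ c, F c ≤ 2 := fun c => by
    simp only [F]; split_ifs
    · have : max 0 (ρ - dist x c.2) ≤ 2 :=
        max_le two_pos.le (by linarith [dist_nonneg (x := x) (y := c.2), min_le_right δ 2])
      linarith
    · exact two_pos.le
  have hFS : ∀ (n : P) p, F (n, X.S p) = 0 := fun n p => by
    simp only [F]; split_ifs
    · rw [max_eq_left (by linarith [hS p]), mul_zero]
    · rfl
  have key := abs_sub_le_pathDist F ?_ ?_ ?_ (m, x) (n, y)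
  · refine lt_of_lt_of_le (abs_pos.2 (sub_ne_zero.2 (ne_of_gt ?_))) key
    have e : F (m, x) = 1 / 3 * ρ := by simp [F, hρ.le]
    rw [e]
    simp only [F]
    split_ifs with hnm
    · have hxy : x ≠ y := fun hxy => h (by rw [hnm, hxy])
      have := dist_pos.2 hxy
      have : max 0 (ρ - dist x y) < ρ := max_lt hρ (by linarith)
      linarith
    · positivity
  · rintro ⟨m', _⟩ ⟨n', _⟩ ⟨p, q, rfl, rfl, -⟩
    rw [hFS, hFS]
  · intro m' z w
    simp only [F]
    split_ifs
    · rw [← mul_sub, abs_mul, abs_of_pos (by norm_num : (0 : ℝ) < 1 / 3)]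
      refine mul_le_mul_of_nonneg_left ?_ (by norm_num)
      refine (abs_max_sub_max_le_max _ _ _ _).trans (max_le (by simp) ?_)
      rw [show ρ - dist x z - (ρ - dist x w) = dist x w - dist x z by ring, dist_comm x w,
        dist_comm x z, dist_comm z w]
      exact abs_dist_sub_le _ _ _
    · simp only [sub_self, abs_zero]; positivity
  · intro c d
    rw [abs_le]
    constructor <;> linarith [hF0 c, hF0 d, hF2 c, hF2 d]

theorem pathDist_pos {a b : M × X} (h : Tensor.mk a ≠ Tensor.mk b) : 0 < pathDist a b := by
  have hne : a ≠ b := fun hab => h (congrArg _ hab)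
  by_cases ha : a.2 ∈ Set.range X.S
  · by_cases hb : b.2 ∈ Set.range X.S
    · obtain ⟨m, x⟩ := a
      obtain ⟨n, y⟩ := b
      obtain ⟨p, rfl⟩ := ha
      obtain ⟨q, rfl⟩ := hb
      refine lt_of_lt_of_le ?_ (dist_contraction_le m n p q)
      exact dist_pos.2 fun he => h (mk_eq_of_contraction_eq m n p q he)
    · rw [pathDist_comm]
      exact pathDist_pos_of_notMem hne.symm hb
  · exact pathDist_pos_of_notMem hne ha

end separation

noncomputable instance (X : SquaMS.{u}) : MetricSpace (Tensor M X) where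
  eq_of_dist_eq_zero {s t} h := by
    induction s using Quot.ind with
    | mk a => induction t using Quot.ind with
      | mk b =>
        by_contra hne
        exact (pathDist_pos hne).ne' h

/-! ### The functor `M ⊗ -` -/

section functor

/-- The third of the unit interval that contains the number `r`. -/
noncomputable def third (r : ℝ) : Fin 3 := if r ≤ 1 / 3 then 0 else if r ≤ 2 / 3 then 1 else 2

theorem third_bounds {r : ℝ} (h0 : 0 ≤ r) (h1 : r ≤ 1) :
    0 ≤ 3 * r - (third r).val ∧ 3 * r - (third r).val ≤ 1 := by
  unfold third; split_ifs <;> norm_num <;> constructor <;> linarith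

theorem third_zero : third 0 = 0 := by simp [third]

theorem third_one : third 1 = 2 := by norm_num [third]

/-- The cell of the boundary point `(r, s)`. -/
noncomputable def cellOf (p : boundary) : M :=
  ⟨(third p.1.fst, third p.1.snd), by
    intro h
    have h1 : third p.1.fst = 1 := congrArg Prod.fst h
    have h2 : third p.1.snd = 1 := congrArg Prod.snd h
    rcases p.2.2 with h | h | h | h <;> simp [h, third_zero, third_one] at h1 h2⟩

/-- The rescaled coordinates of a boundary point within its cell. -/
noncomputable def localPoint (p : boundary) : boundary :=
  ⟨WithLp.toLp 1 (3 * p.1.fst - (third p.1.fst).val, 3 * p.1.snd - (third p.1.snd).val), by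
    obtain ⟨h1, h2, h3, h4⟩ := p.2.1
    obtain ⟨a1, a2⟩ := third_bounds h1 h2
    obtain ⟨b1, b2⟩ := third_bounds h3 h4
    refine ⟨⟨a1, a2, b1, b2⟩, ?_⟩
    rcases p.2.2 with h | h | h | h <;> rw [h] <;> norm_num [third_zero, third_one]⟩

theorem contraction_localPoint (p : boundary) : contraction (cellOf p).1 (localPoint p).1 = p.1 := by
  apply plane_ext
  · rw [contraction_fst]; simp [cellOf, localPoint]
  · rw [contraction_snd]; simp [cellOf, localPoint]

/-- The boundary map of `M ⊗ X`: each side consists of three copies of that side of `X`. For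
instance, `(0, r)` goes to `(0, 0) ⊗ S (0, 3 r)` for `r ≤ 1/3`, to `(0, 1) ⊗ S (0, 3 r - 1)` for
`1/3 ≤ r ≤ 2/3`, and to `(0, 2) ⊗ S (0, 3 r - 2)` for `2/3 ≤ r`. -/
noncomputable def tensorS (X : SquaMS.{u}) (p : boundary) : Tensor M X :=
  Tensor.mk (cellOf p, X.S (localPoint p))

/-- The boundary map does not depend on the choice of a cell for the points on two cells. -/
theorem tensorS_eq (X : SquaMS.{u}) (p q : boundary) (m : M) (h : contraction m q = p) :
    tensorS X p = Tensor.mk (m, X.S q) :=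
  mk_eq_of_contraction_eq _ _ _ _ (by rw [contraction_localPoint, h])

theorem tensorS_sq2 (X : SquaMS.{u}) (p q : boundary) :
    |p.1.fst - q.1.fst| + |p.1.snd - q.1.snd| ≤ dist (tensorS X p) (tensorS X q) := by
  rw [← dist_plane, ← contraction_localPoint p, ← contraction_localPoint q]
  exact dist_contraction_le _ _ _ _

/-- A parametrised side of `M ⊗ X` consisting of three segments, each of which is isometric to a
segment of length `1/3`. -/
theorem dist_le_of_thirds {Y : Type*} [PseudoMetricSpace Y] (γ : ℝ → Y)
    (h : ∀ k : ℕ, k < 3 → ∀ r s : ℝ, (k : ℝ) / 3 ≤ r → r ≤ s → s ≤ (k + 1) / 3 →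
      dist (γ r) (γ s) ≤ s - r) (r s : ℝ) (hr : 0 ≤ r) (hrs : r ≤ s) (hs : s ≤ 1) :
    dist (γ r) (γ s) ≤ s - r := by
  have h0 := h 0 (by norm_num)
  have h1 := h 1 (by norm_num)
  have h2 := h 2 (by norm_num)
  norm_num at h0 h1 h2
  have two : ∀ r s : ℝ, 0 ≤ r → r ≤ s → s ≤ 2 / 3 → dist (γ r) (γ s) ≤ s - r := by
    intro r s hr hrs hs
    rcases le_total s (1 / 3) with c | c
    · exact h0 r s hr hrs c
    rcases le_total (1 / 3) r with d | d
    · exact h1 r s d hrs hs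
    · linarith [dist_triangle (γ r) (γ (1 / 3)) (γ s), h0 r (1 / 3) hr d le_rfl,
        h1 (1 / 3) s le_rfl c hs]
  rcases le_total s (2 / 3) with c | c
  · exact two r s hr hrs c
  rcases le_total (2 / 3) r with d | d
  · exact h2 r s d hrs hs
  · linarith [dist_triangle (γ r) (γ (2 / 3)) (γ s), two r (2 / 3) hr d le_rfl,
      h2 (2 / 3) s le_rfl c hs]

theorem vertical_mem {a r : ℝ} (ha : a = 0 ∨ a = 1) (h0 : 0 ≤ r) (h1 : r ≤ 1) :
    (WithLp.toLp 1 (a, r) : Plane) ∈ boundary :=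
  ⟨⟨by rcases ha with rfl | rfl <;> simp, by rcases ha with rfl | rfl <;> simp, h0, h1⟩, by
    rcases ha with rfl | rfl <;> simp⟩

theorem horizontal_mem {a r : ℝ} (ha : a = 0 ∨ a = 1) (h0 : 0 ≤ r) (h1 : r ≤ 1) :
    (WithLp.toLp 1 (r, a) : Plane) ∈ boundary :=
  ⟨⟨h0, h1, by rcases ha with rfl | rfl <;> simp, by rcases ha with rfl | rfl <;> simp⟩, by
    rcases ha with rfl | rfl <;> simp⟩

/-- The column or row of cells along a side. -/
theorem exists_side {a : ℝ} (ha : a = 0 ∨ a = 1) :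
    ∃ c : Fin 3, c ≠ 1 ∧ (c.val + a) / 3 = a := by
  rcases ha with rfl | rfl
  · exact ⟨0, by decide, by norm_num⟩
  · exact ⟨2, by decide, by norm_num⟩

theorem tensorS_vertical (X : SquaMS.{u}) {a r s : ℝ} (ha : a = 0 ∨ a = 1) (hr : 0 ≤ r)
    (hrs : r ≤ s) (hs : s ≤ 1) :
    dist (tensorS X ⟨_, vertical_mem ha hr (hrs.trans hs)⟩)
      (tensorS X ⟨_, vertical_mem ha (hr.trans hrs) hs⟩) ≤ s - r := by
  classical
  obtain ⟨c, hc, hca⟩ := exists_side ha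
  set γ : ℝ → Tensor M X := fun t =>
    if h : (WithLp.toLp 1 (a, t) : Plane) ∈ boundary then tensorS X ⟨_, h⟩
    else tensorS X ⟨_, corner_mem ha ha⟩ with hγ
  have key := dist_le_of_thirds γ ?_ r s hr hrs hs
  · simpa only [hγ, dif_pos (vertical_mem ha hr (hrs.trans hs)),
      dif_pos (vertical_mem ha (hr.trans hrs) hs)] using key
  · intro k hk r s hr hrs hs
    have hk0 : (0 : ℝ) ≤ k := by positivity
    have hk2 : (k : ℝ) ≤ 2 := by exact_mod_cast (by omega : k ≤ 2)
    have e : ∀ t : ℝ, ∀ h1 : (k : ℝ) / 3 ≤ t, ∀ h2 : t ≤ (k + 1) / 3,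
        γ t = Tensor.mk ((⟨(c, ⟨k, hk⟩), fun h => hc (congrArg Prod.fst h)⟩ : M),
          X.S ⟨_, vertical_mem (r := 3 * t - k) ha (by linarith) (by linarith)⟩) := by
      intro t h1 h2
      simp only [hγ]
      rw [dif_pos (vertical_mem ha (by linarith) (by linarith))]
      refine tensorS_eq _ _ _ _ (plane_ext ?_ ?_)
      · rw [contraction_fst]; exact hca
      · rw [contraction_snd]; simp
    rw [e r hr (hrs.trans hs), e s (hr.trans hrs) hs]
    refine (dist_mk_le _ _ _).trans (le_of_eq ?_)
    rw [X.sq1_vertical ⟨WithLp.toLp 1 (a, 3 * r - k), vertical_mem ha (by linarith) (by linarith)⟩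
      ⟨WithLp.toLp 1 (a, 3 * s - k), vertical_mem ha (by linarith) (by linarith)⟩ rfl ha]
    change 1 / 3 * |3 * s - k - (3 * r - k)| = s - r
    rw [abs_of_nonneg (by linarith)]; ring

theorem tensorS_horizontal (X : SquaMS.{u}) {a r s : ℝ} (ha : a = 0 ∨ a = 1) (hr : 0 ≤ r)
    (hrs : r ≤ s) (hs : s ≤ 1) :
    dist (tensorS X ⟨_, horizontal_mem ha hr (hrs.trans hs)⟩)
      (tensorS X ⟨_, horizontal_mem ha (hr.trans hrs) hs⟩) ≤ s - r := by
  classical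
  obtain ⟨c, hc, hca⟩ := exists_side ha
  set γ : ℝ → Tensor M X := fun t =>
    if h : (WithLp.toLp 1 (t, a) : Plane) ∈ boundary then tensorS X ⟨_, h⟩
    else tensorS X ⟨_, corner_mem ha ha⟩ with hγ
  have key := dist_le_of_thirds γ ?_ r s hr hrs hs
  · simpa only [hγ, dif_pos (horizontal_mem ha hr (hrs.trans hs)),
      dif_pos (horizontal_mem ha (hr.trans hrs) hs)] using key
  · intro k hk r s hr hrs hs
    have hk0 : (0 : ℝ) ≤ k := by positivity
    have hk2 : (k : ℝ) ≤ 2 := by exact_mod_cast (by omega : k ≤ 2)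
    have e : ∀ t : ℝ, ∀ h1 : (k : ℝ) / 3 ≤ t, ∀ h2 : t ≤ (k + 1) / 3,
        γ t = Tensor.mk ((⟨(⟨k, hk⟩, c), fun h => hc (congrArg Prod.snd h)⟩ : M),
          X.S ⟨_, horizontal_mem (r := 3 * t - k) ha (by linarith) (by linarith)⟩) := by
      intro t h1 h2
      simp only [hγ]
      rw [dif_pos (horizontal_mem ha (by linarith) (by linarith))]
      refine tensorS_eq _ _ _ _ (plane_ext ?_ ?_)
      · rw [contraction_fst]; simp
      · rw [contraction_snd]; exact hca
    rw [e r hr (hrs.trans hs), e s (hr.trans hrs) hs]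
    refine (dist_mk_le _ _ _).trans (le_of_eq ?_)
    rw [X.sq1_horizontal ⟨WithLp.toLp 1 (3 * r - k, a), horizontal_mem ha (by linarith) (by linarith)⟩
      ⟨WithLp.toLp 1 (3 * s - k, a), horizontal_mem ha (by linarith) (by linarith)⟩ rfl ha]
    change 1 / 3 * |3 * s - k - (3 * r - k)| = s - r
    rw [abs_of_nonneg (by linarith)]; ring

theorem tensorS_sq1_vertical (X : SquaMS.{u}) (p q : boundary) (h : p.1.fst = q.1.fst)
    (hp : p.1.fst = 0 ∨ p.1.fst = 1) :
    dist (tensorS X p) (tensorS X q) = |q.1.snd - p.1.snd| := by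
  have lower := tensorS_sq2 X p q
  rw [h, sub_self, abs_zero, zero_add, abs_sub_comm] at lower
  refine le_antisymm ?_ lower
  have ep : p = ⟨_, vertical_mem hp p.2.1.2.2.1 p.2.1.2.2.2⟩ := Subtype.ext rfl
  have eq : q = ⟨_, vertical_mem hp q.2.1.2.2.1 q.2.1.2.2.2⟩ :=
    Subtype.ext (plane_ext h.symm rfl)
  rcases le_total p.1.snd q.1.snd with hle | hle
  · rw [abs_of_nonneg (by linarith), ep, eq]
    exact tensorS_vertical X hp p.2.1.2.2.1 hle q.2.1.2.2.2
  · rw [abs_of_nonpos (by linarith), dist_comm, ep, eq, neg_sub]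
    exact tensorS_vertical X hp q.2.1.2.2.1 hle p.2.1.2.2.2

theorem tensorS_sq1_horizontal (X : SquaMS.{u}) (p q : boundary) (h : p.1.snd = q.1.snd)
    (hp : p.1.snd = 0 ∨ p.1.snd = 1) :
    dist (tensorS X p) (tensorS X q) = |q.1.fst - p.1.fst| := by
  have lower := tensorS_sq2 X p q
  rw [h, sub_self, abs_zero, add_zero, abs_sub_comm] at lower
  refine le_antisymm ?_ lower
  have ep : p = ⟨_, horizontal_mem hp p.2.1.1 p.2.1.2.1⟩ := Subtype.ext rfl
  have eq : q = ⟨_, horizontal_mem hp q.2.1.1 q.2.1.2.1⟩ :=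
    Subtype.ext (plane_ext rfl h.symm)
  rcases le_total p.1.fst q.1.fst with hle | hle
  · rw [abs_of_nonneg (by linarith), ep, eq]
    exact tensorS_horizontal X hp p.2.1.1 hle q.2.1.2.1
  · rw [abs_of_nonpos (by linarith), dist_comm, ep, eq, neg_sub]
    exact tensorS_horizontal X hp q.2.1.1 hle p.2.1.2.1

/-- The square metric space `M ⊗ X`. -/
noncomputable def tensorObj (X : SquaMS.{u}) : SquaMS.{u} where
  carrier := Tensor M X
  S := tensorS X
  S_injective p q h := by
    have := tensorS_sq2 X p q
    rw [h, dist_self, ← dist_plane] at this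
    exact Subtype.ext (dist_le_zero.1 this)
  dist_le_two := dist_tensor_le_two
  sq1_vertical := tensorS_sq1_vertical X
  sq1_horizontal := tensorS_sq1_horizontal X
  sq2 := tensorS_sq2 X

/-- The map `m ⊗ x ↦ m ⊗ f x`, for a map `f` which preserves `S`. -/
def tensorFun (P : Set Cell) {X Y : SquaMS.{u}} (f : X → Y) (hf : ∀ p, f (X.S p) = Y.S p) :
    Tensor P X → Tensor P Y :=
  Quot.map (fun a => (a.1, f a.2)) (by
    rintro ⟨m, _⟩ ⟨n, _⟩ ⟨p, q, rfl, rfl, h⟩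
    exact ⟨p, q, hf p, hf q, h⟩)

theorem dist_tensorFun_le (P : Set Cell) {X Y : SquaMS.{u}} (f : SquaMS.Hom X Y)
    (s t : Tensor P X) :
    dist (tensorFun P f.toFun f.map_S s) (tensorFun P f.toFun f.map_S t) ≤ dist s t := by
  induction s using Quot.ind with
  | mk a => induction t using Quot.ind with
    | mk b =>
      refine dist_le_pathDist (fun a => tensorFun P f.toFun f.map_S (Tensor.mk a)) ?_ a b
      intro a b
      by_cases h : Tensor.mk a = Tensor.mk b
      · rw [h, dist_self]; exact stepScore_nonneg a b
      · obtain ⟨m, x⟩ := a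
        obtain ⟨n, y⟩ := b
        simp only [stepScore, h, if_false]
        split_ifs with h'
        · subst h'
          exact (dist_mk_le m (f.toFun x) (f.toFun y)).trans
            (mul_le_mul_of_nonneg_left (f.short x y) (by norm_num))
        · exact dist_tensor_le_two _ _

/-- The functor `M ⊗ -` on square metric spaces. -/
noncomputable def tensorM : SquaMS.{u} ⥤ SquaMS.{u} where
  obj := tensorObj
  map {X Y} f := ⟨tensorFun M f.toFun f.map_S, dist_tensorFun_le M f,
    fun p => congrArg (fun y => Tensor.mk (cellOf p, y)) (f.map_S (localPoint p))⟩
  map_id X := by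
    refine SquaMS.Hom.ext (funext fun s => ?_)
    induction s using Quot.ind with
    | mk a => rfl
  map_comp f g := by
    refine SquaMS.Hom.ext (funext fun s => ?_)
    induction s using Quot.ind with
    | mk a => rfl

/-- An algebra `a : F A ⟶ A` is corecursive if for each coalgebra `e : X ⟶ F X` there is exactly one
coalgebra-to-algebra morphism, that is, one `h : X ⟶ A` with `h = a ∘ F h ∘ e`. -/
def IsCorecursive {C : Type*} [Category C] {F : C ⥤ C} (A : Endofunctor.Algebra F) : Prop :=
  ∀ X : Endofunctor.Coalgebra F, ∃! h : X.V ⟶ A.a, h = X.str ≫ F.map h ≫ A.str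

end functor

/-! ### The Sierpinski carpet -/

section carpet

/-- The map `σ(A) = ⋃_{m ∈ M} σ_m(A)` on subsets of the plane. -/
def hutchinson (A : Set Plane) : Set Plane := ⋃ m ∈ M, contraction m '' A

/-- The properties which characterise the Sierpinski carpet. -/
def IsCarpet (A : Set Plane) : Prop :=
  A ⊆ unitSquare ∧ A.Nonempty ∧ IsCompact A ∧ hutchinson A = A

theorem hutchinson_mono {A B : Set Plane} (h : A ⊆ B) : hutchinson A ⊆ hutchinson B :=
  Set.iUnion₂_mono fun _ _ => Set.image_mono h

theorem mem_hutchinson {A : Set Plane} {p : Plane} :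
    p ∈ hutchinson A ↔ ∃ m : M, ∃ q ∈ A, contraction m q = p := by
  simp [hutchinson]

theorem IsCarpet.subset {A B : Set Plane} (hA : IsCarpet A) (hB : IsCarpet B) : A ⊆ B := by
  obtain ⟨-, hA2, hA3, hA4⟩ := hA
  obtain ⟨-, hB2, hB3, hB4⟩ := hB
  obtain ⟨a, ha, hmax⟩ := hA3.exists_isMaxOn hA2 (Metric.continuous_infDist_pt B).continuousOn
  have h0 : Metric.infDist a B ≤ 0 := by
    have ha' := ha
    rw [← hA4, mem_hutchinson] at ha'
    obtain ⟨m, q, hq, rfl⟩ := ha'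
    obtain ⟨b, hb, hqb⟩ := hB3.exists_infDist_eq_dist hB2 q
    have h1 : contraction m b ∈ B := hB4.subset (mem_hutchinson.2 ⟨m, b, hb, rfl⟩)
    have h2 := Metric.infDist_le_dist_of_mem (x := contraction m q) h1
    rw [dist_contraction, ← hqb] at h2
    have h3 : Metric.infDist q B ≤ Metric.infDist (contraction m q) B := hmax hq
    linarith
  intro x hx
  rw [hB3.isClosed.mem_iff_infDist_zero hB2]
  exact le_antisymm ((hmax hx).trans h0) Metric.infDist_nonneg

/-- The sets `σ^k(U₀)`. -/
def stage : ℕ → Set Plane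
  | 0 => unitSquare
  | k + 1 => hutchinson (stage k)

theorem stage_succ_subset (k : ℕ) : stage (k + 1) ⊆ stage k := by
  induction k with
  | zero =>
    intro p hp
    obtain ⟨m, q, hq, rfl⟩ := mem_hutchinson.1 hp
    exact contraction_mem m hq
  | succ k ih => exact hutchinson_mono ih

theorem boundary_subset_stage (k : ℕ) : boundary ⊆ stage k := by
  induction k with
  | zero => exact fun p hp => hp.1
  | succ k ih =>
    intro p hp
    exact mem_hutchinson.2 ⟨cellOf ⟨p, hp⟩, localPoint ⟨p, hp⟩, ih (localPoint ⟨p, hp⟩).2,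
      contraction_localPoint ⟨p, hp⟩⟩

theorem continuous_contraction (m : Cell) : Continuous (contraction m) :=
  continuous_const.add (continuous_id.const_smul (1 / 3 : ℝ))

theorem isCompact_stage (k : ℕ) : IsCompact (stage k) := by
  induction k with
  | zero => exact isCompact_unitSquare
  | succ k ih =>
    exact (Set.toFinite M).isCompact_biUnion fun m _ => ih.image (continuous_contraction m)

theorem isCarpet_iInter_stage : IsCarpet (⋂ k, stage k) := by
  refine ⟨Set.iInter_subset stage 0, ?_, ?_, ?_⟩
  · exact ⟨_, Set.mem_iInter.2 fun k => boundary_subset_stage k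
      (corner_mem (Or.inl rfl) (Or.inl rfl))⟩
  · exact (isCompact_stage 0).of_isClosed_subset
      (isClosed_iInter fun k => (isCompact_stage k).isClosed) (Set.iInter_subset stage 0)
  · refine Set.Subset.antisymm ?_ ?_
    · refine Set.subset_iInter fun k => ?_
      exact (hutchinson_mono (Set.iInter_subset stage k)).trans (stage_succ_subset k)
    · intro p hp
      have hp' : ∀ k, ∃ m : M, p ∈ contraction m '' stage k := fun k =>
        mem_hutchinson.1 (Set.mem_iInter.1 hp (k + 1))
      choose f hf using hp'
      obtain ⟨m, hm⟩ := Finite.exists_infinite_fiber f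
      have hinf : (f ⁻¹' {m}).Infinite := Set.infinite_coe_iff.1 hm
      obtain ⟨k₀, hk₀⟩ := hinf.nonempty
      obtain ⟨q, hq, hqp⟩ := hf k₀
      rw [hk₀] at hqp
      refine mem_hutchinson.2 ⟨m, q, Set.mem_iInter.2 fun k => ?_, hqp⟩
      obtain ⟨l, hl, hkl⟩ := hinf.exists_gt k
      obtain ⟨q', hq', hqp'⟩ := hf l
      rw [hl] at hqp'
      have : q' = q := contraction_injective m (hqp'.trans hqp.symm)
      exact antitone_nat_of_succ_le stage_succ_subset hkl.le (this ▸ hq')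

theorem existsUnique_isCarpet : ∃! A : Set Plane, IsCarpet A :=
  ⟨_, isCarpet_iInter_stage, fun _ hA =>
    Set.Subset.antisymm (hA.subset isCarpet_iInter_stage) (isCarpet_iInter_stage.subset hA)⟩

/-- The Sierpinski carpet: the unique non-empty compact subset of the unit square which is fixed
by `σ`. -/
def carpetSet : Set Plane := existsUnique_isCarpet.choose

theorem isCarpet_carpetSet : IsCarpet carpetSet := existsUnique_isCarpet.choose_spec.1

theorem boundary_subset_carpetSet : boundary ⊆ carpetSet := by
  rw [existsUnique_isCarpet.unique isCarpet_carpetSet isCarpet_iInter_stage]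
  exact Set.subset_iInter boundary_subset_stage

theorem contraction_mem_carpetSet (m : M) {p : Plane} (hp : p ∈ carpetSet) :
    contraction m p ∈ carpetSet := by
  rw [← isCarpet_carpetSet.2.2.2]
  exact mem_hutchinson.2 ⟨m, p, hp, rfl⟩

theorem dist_le_two_of_mem {p q : Plane} (hp : p ∈ unitSquare) (hq : q ∈ unitSquare) :
    dist p q ≤ 2 := by
  obtain ⟨p1, p2, p3, p4⟩ := hp
  obtain ⟨q1, q2, q3, q4⟩ := hq
  rw [dist_plane]
  have h1 : |p.fst - q.fst| ≤ 1 := abs_le.2 ⟨by linarith, by linarith⟩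
  have h2 : |p.snd - q.snd| ≤ 1 := abs_le.2 ⟨by linarith, by linarith⟩
  linarith

/-- The inclusion of the boundary into a larger set. -/
def subS (A : Set Plane) (h : boundary ⊆ A) (p : boundary) : ULift.{u} A :=
  ULift.up (Set.inclusion h p)

/-- A subset of the unit square which contains the boundary, with the taxicab metric and the inclusion
of the boundary, as a square metric space (in an arbitrary universe). -/
noncomputable def subSquare (A : Set Plane) (h1 : boundary ⊆ A) (h2 : A ⊆ unitSquare) : SquaMS.{u} where
  carrier := ULift.{u} A
  S := subS A h1
  S_injective _ _ h := Set.inclusion_injective h1 (ULift.up_injective h)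
  dist_le_two x y := dist_le_two_of_mem (h2 x.down.2) (h2 y.down.2)
  sq1_vertical p q h _ := by
    change dist p.1 q.1 = _
    rw [dist_plane, h, sub_self, abs_zero, zero_add, abs_sub_comm]
  sq1_horizontal p q h _ := by
    change dist p.1 q.1 = _
    rw [dist_plane, h, sub_self, abs_zero, add_zero, abs_sub_comm]
  sq2 p q := (dist_plane p.1 q.1).ge

/-- The unit square `U₀` as a square metric space. -/
noncomputable def square : SquaMS.{u} := subSquare unitSquare (fun _ hp => hp.1) subset_rfl

/-- The Sierpinski carpet `𝕊` as a square metric space. -/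
noncomputable def carpet : SquaMS.{u} :=
  subSquare carpetSet boundary_subset_carpetSet isCarpet_carpetSet.1

/-- The map `α_N : N ⊗ U₀ → U₀`, `n ⊗ z ↦ shrink n + z / 3`. -/
noncomputable def alphaN : Tensor N square.{u} → square.{u} :=
  Quot.lift (fun a => ⟨⟨contraction a.1 a.2.down.1, contraction_mem a.1 a.2.down.2⟩⟩) (by
    rintro ⟨m, _⟩ ⟨n, _⟩ ⟨p, q, rfl, rfl, h⟩
    exact congrArg ULift.up (Subtype.ext (contraction_eq_of_glued h)))

/-- The map `M ⊗ 𝕊 → N ⊗ U₀`, `m ⊗ s ↦ m ⊗ s`, induced by the inclusions `M ⊆ N` and `𝕊 ⊆ U₀`. -/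
def inclusion : Tensor M carpet.{u} → Tensor N square.{u} :=
  Quot.map (fun a => (⟨a.1.1, trivial⟩, ⟨⟨a.2.down.1, isCarpet_carpetSet.1 a.2.down.2⟩⟩)) (by
    rintro ⟨m, _⟩ ⟨n, _⟩ ⟨p, q, rfl, rfl, h⟩
    exact ⟨p, q, rfl, rfl, h⟩)

theorem alphaN_inclusion_mem (s : Tensor M carpet.{u}) :
    (alphaN (inclusion s)).down.1 ∈ carpetSet := by
  induction s using Quot.ind with
  | mk a => exact contraction_mem_carpetSet a.1 a.2.down.2

/-- The map `τ : M ⊗ 𝕊 → 𝕊`, the restriction of `α_N`. -/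
noncomputable def tauFun (s : Tensor M carpet.{u}) : carpet.{u} :=
  ⟨⟨(alphaN (inclusion s)).down.1, alphaN_inclusion_mem s⟩⟩

theorem tauFun_mk (m : M) (s : carpet.{u}) :
    (tauFun (Tensor.mk (m, s))).down.1 = shrink m + (1 / 3 : ℝ) • s.down.1 := rfl

/-- The morphism `τ : M ⊗ 𝕊 ⟶ 𝕊` of square metric spaces. -/
noncomputable def tau : tensorM.obj carpet.{u} ⟶ carpet.{u} where
  toFun := tauFun
  short s t := by
    induction s using Quot.ind with
    | mk a => induction t using Quot.ind with
      | mk b =>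
        refine dist_le_pathDist (fun a => tauFun (Tensor.mk a)) ?_ a b
        intro a b
        by_cases h : Tensor.mk a = Tensor.mk b
        · rw [h, dist_self]; exact stepScore_nonneg a b
        · obtain ⟨m, x⟩ := a
          obtain ⟨n, y⟩ := b
          simp only [stepScore, h, if_false]
          split_ifs with h'
          · subst h'
            exact (dist_contraction m x.down.1 y.down.1).le
          · exact carpet.dist_le_two _ _
  map_S p := congrArg ULift.up (Subtype.ext (contraction_localPoint p))

end carpet

end Sierpinski

/-!
Morphisms `X ⟶ Y` of square metric spaces form a metric space under the uniform distance, complete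
if `Y` is, and `M ⊗ -` multiplies the distance of morphisms by at most `1/3`. So for an algebra `A`
with a complete carrier and a coalgebra `β` on `B`, the equation `h = a ∘ (M ⊗ h) ∘ β` is a fixed
point equation for a contraction, and has exactly one solution as soon as there is some morphism
`B ⟶ A`. There are always morphisms to the unit square `U₀`, because in the coordinates `r + s`,
`r - s` the taxicab metric is a supremum metric, for which short maps extend. Hence `U₀` is
corecursive. The range of a solution in `U₀` is contained in the union of its images
under the eight contractions defining `𝕊`, so it lies in `𝕊`, and the property passes to `𝕊`.

The inverse of `τ` is not short because two points on opposite sides of the central hole are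
joined in the plane by a segment through the hole, of length `1/3`, while in `M ⊗ 𝕊` one has to go
around it.
-/

namespace Sierpinski

open CategoryTheory Function
open scoped NNReal UniformConvergence

section hom

variable {X Y Z : SquaMS.{u}}

instance : BoundedSpace X :=
  Metric.boundedSpace_iff.2 ⟨2, X.dist_le_two⟩

theorem mono_of_injective {f : X ⟶ Y} (hf : Injective f.toFun) : Mono f where
  right_cancellation _ _ hgh :=
    SquaMS.Hom.ext (funext fun z => hf (congrFun (congrArg SquaMS.Hom.toFun hgh) z))

theorem injective_ofFun_toFun :
    Injective fun f : X ⟶ Y => (UniformFun.ofFun f.toFun : X →ᵤ Y) :=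
  fun _ _ h => SquaMS.Hom.ext (UniformFun.ofFun.injective h)

noncomputable instance : MetricSpace (X ⟶ Y) :=
  MetricSpace.induced _ injective_ofFun_toFun inferInstance

theorem isometry_ofFun_toFun : Isometry fun f : X ⟶ Y => (UniformFun.ofFun f.toFun : X →ᵤ Y) :=
  Isometry.of_dist_eq fun _ _ => rfl

theorem dist_hom_le {f g : X ⟶ Y} {C : ℝ} (hC : 0 ≤ C) :
    dist f g ≤ C ↔ ∀ x, dist (f.toFun x) (g.toFun x) ≤ C :=
  UniformFun.dist_le hC

theorem dist_apply_le_dist_hom (f g : X ⟶ Y) (x : X) :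
    dist (f.toFun x) (g.toFun x) ≤ dist f g :=
  (dist_hom_le dist_nonneg).1 le_rfl x

theorem dist_comp_left_le (e : X ⟶ Y) (f g : Y ⟶ Z) : dist (e ≫ f) (e ≫ g) ≤ dist f g :=
  (dist_hom_le dist_nonneg).2 fun x => dist_apply_le_dist_hom f g (e.toFun x)

theorem dist_comp_right_le (f g : X ⟶ Y) (a : Y ⟶ Z) : dist (f ≫ a) (g ≫ a) ≤ dist f g :=
  (dist_hom_le dist_nonneg).2 fun x => (a.short _ _).trans (dist_apply_le_dist_hom f g x)

theorem isClosed_range_ofFun_toFun :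
    IsClosed (Set.range fun f : X ⟶ Y => (UniformFun.ofFun f.toFun : X →ᵤ Y)) := by
  have range_eq : (Set.range fun f : X ⟶ Y => (UniformFun.ofFun f.toFun : X →ᵤ Y)) =
      {f | ∀ x y, dist (UniformFun.toFun f x) (UniformFun.toFun f y) ≤ dist x y} ∩
        {f | ∀ p, UniformFun.toFun f (X.S p) = Y.S p} := by
    ext f
    constructor
    · rintro ⟨g, rfl⟩
      exact ⟨g.short, g.map_S⟩
    · rintro ⟨short, map_S⟩
      exact ⟨⟨UniformFun.toFun f, short, map_S⟩, rfl⟩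
  have continuous_eval (x : X) : Continuous fun f : X →ᵤ Y => UniformFun.toFun f x :=
    (UniformFun.lipschitzWith_eval x).continuous
  simp only [range_eq, Set.ofPred_forall]
  refine IsClosed.inter ?_ ?_
  · exact isClosed_iInter fun x => isClosed_iInter fun y =>
      isClosed_le ((continuous_eval x).dist (continuous_eval y)) continuous_const
  · exact isClosed_iInter fun p => isClosed_eq (continuous_eval _) continuous_const

instance [CompleteSpace Y] : CompleteSpace (X ⟶ Y) :=
  (completeSpace_iff_isComplete_range isometry_ofFun_toFun.isUniformInducing).2
    isClosed_range_ofFun_toFun.isComplete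

end hom

section corecursive

theorem IsCorecursive.of_mono {C : Type*} [Category C] {F : C ⥤ C} {A A' : Endofunctor.Algebra F}
    (hA : IsCorecursive A) (i : A' ⟶ A) [Mono i.f]
    (hi : ∀ (X : Endofunctor.Coalgebra F) (h : X.V ⟶ A.a),
      h = X.str ≫ F.map h ≫ A.str → ∃ k, k ≫ i.f = h) : IsCorecursive A' := by
  intro X
  have comp_incl (k : X.V ⟶ A'.a) : X.str ≫ F.map (k ≫ i.f) ≫ A.str =
      (X.str ≫ F.map k ≫ A'.str) ≫ i.f := by
    simp only [F.map_comp, Category.assoc, i.h]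
  obtain ⟨h, h_sol, h_unique⟩ := hA X
  obtain ⟨k, rfl⟩ := hi X h h_sol
  refine ⟨k, (cancel_mono i.f).1 (h_sol.trans (comp_incl k)), fun l l_sol => ?_⟩
  refine (cancel_mono i.f).1 (h_unique _ ?_)
  dsimp only
  rw [comp_incl, ← l_sol]

theorem isCorecursive_of_lipschitzWith_map {F : SquaMS.{u} ⥤ SquaMS.{u}} {K : ℝ≥0} (hK : K < 1)
    (hF : ∀ X Y : SquaMS.{u}, LipschitzWith K fun f : X ⟶ Y => F.map f)
    {A : Endofunctor.Algebra F} [CompleteSpace A.a]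
    (hA : ∀ X : Endofunctor.Coalgebra F, Nonempty (X.V ⟶ A.a)) : IsCorecursive A := by
  intro X
  have := hA X
  have contracting : ContractingWith K fun h : X.V ⟶ A.a => X.str ≫ F.map h ≫ A.str :=
    ⟨hK, LipschitzWith.of_dist_le_mul fun f g =>
      (dist_comp_left_le _ _ _).trans
        ((dist_comp_right_le _ _ _).trans ((hF _ _).dist_le_mul f g))⟩
  exact ⟨_, contracting.fixedPoint_isFixedPt.symm,
    fun h h_sol => contracting.fixedPoint_unique h_sol.symm⟩

theorem lipschitzWith_tensorM_map (X Y : SquaMS.{u}) :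
    LipschitzWith (1 / 3) fun f : X ⟶ Y => tensorM.map f := by
  refine LipschitzWith.of_dist_le_mul fun f g => (dist_hom_le (by positivity)).2 fun s => ?_
  induction s using Quot.ind with
  | mk a =>
    calc dist (Tensor.mk (a.1, f.toFun a.2)) (Tensor.mk (a.1, g.toFun a.2))
      _ ≤ 1 / 3 * dist (f.toFun a.2) (g.toFun a.2) := dist_mk_le _ _ _
      _ ≤ ((1 / 3 : ℝ≥0) : ℝ) * dist f g := by
        push_cast
        gcongr
        exact dist_apply_le_dist_hom f g a.2

end corecursive

section square

theorem abs_add_add_abs_sub_le {a b c : ℝ} (ha : |a| ≤ c) (hb : |b| ≤ c) :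
    |a + b| + |a - b| ≤ 2 * c := by
  rw [abs_le] at ha hb
  rcases abs_cases (a + b) with ⟨h, -⟩ | ⟨h, -⟩ <;>
    rcases abs_cases (a - b) with ⟨h', -⟩ | ⟨h', -⟩ <;> linarith

/-- The coordinatewise projection of the plane to the unit square. -/
noncomputable def projSquare (p : Plane) : Plane :=
  WithLp.toLp 1 (Set.projIcc (0 : ℝ) 1 zero_le_one p.fst, Set.projIcc (0 : ℝ) 1 zero_le_one p.snd)

theorem projSquare_mem (p : Plane) : projSquare p ∈ unitSquare :=
  have ⟨fst_nonneg, fst_le⟩ := (Set.projIcc (0 : ℝ) 1 zero_le_one p.fst).2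
  ⟨fst_nonneg, fst_le, (Set.projIcc (0 : ℝ) 1 zero_le_one p.snd).2⟩

theorem projSquare_of_mem {p : Plane} (hp : p ∈ unitSquare) : projSquare p = p :=
  plane_ext (congrArg Subtype.val (Set.projIcc_of_mem zero_le_one ⟨hp.1, hp.2.1⟩))
    (congrArg Subtype.val (Set.projIcc_of_mem zero_le_one hp.2.2))

theorem dist_projSquare_le (p q : Plane) : dist (projSquare p) (projSquare q) ≤ dist p q := by
  have proj_short (s t : ℝ) : |(Set.projIcc (0 : ℝ) 1 zero_le_one s : ℝ) -
      Set.projIcc (0 : ℝ) 1 zero_le_one t| ≤ |s - t| := by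
    simpa only [NNReal.coe_one, one_mul, Subtype.dist_eq, Real.dist_eq] using
      (LipschitzWith.projIcc zero_le_one).dist_le_mul s t
  rw [dist_plane, dist_plane]
  exact add_le_add (proj_short _ _) (proj_short _ _)

theorem exists_short_extension_plane (X : SquaMS.{u}) :
    ∃ f : X → Plane, (∀ x y, dist (f x) (f y) ≤ dist x y) ∧ ∀ p, f (X.S p) = p.1 := by
  obtain ⟨v, v_short, v_S, -⟩ := exists_short_extension X 1 0 (Or.inl ⟨rfl, rfl⟩)
  obtain ⟨w, w_short, w_S, -⟩ := exists_short_extension X (-1) (-1) (Or.inr ⟨rfl, rfl⟩)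
  refine ⟨fun x => WithLp.toLp 1 ((v x + w x) / 2, (v x - w x) / 2), fun x y => ?_, fun p => ?_⟩
  · calc dist (WithLp.toLp 1 ((v x + w x) / 2, (v x - w x) / 2) : Plane)
          (WithLp.toLp 1 ((v y + w y) / 2, (v y - w y) / 2))
      _ = |(v x - v y) / 2 + (w x - w y) / 2| + |(v x - v y) / 2 - (w x - w y) / 2| := by
        rw [dist_plane]; congr 2 <;> dsimp only [WithLp.toLp_fst, WithLp.toLp_snd] <;> ring
      _ ≤ 2 * (dist x y / 2) := by
        refine abs_add_add_abs_sub_le ?_ ?_ <;> rw [abs_div, abs_two]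
        · exact div_le_div_of_nonneg_right (v_short x y) two_pos.le
        · exact div_le_div_of_nonneg_right (w_short x y) two_pos.le
      _ = dist x y := by ring
  · dsimp only
    rw [v_S, w_S]
    refine plane_ext ?_ ?_ <;> dsimp only [WithLp.toLp_fst, WithLp.toLp_snd] <;> ring

theorem nonempty_hom_square (X : SquaMS.{u}) : Nonempty (X ⟶ square.{u}) := by
  obtain ⟨f, f_short, f_S⟩ := exists_short_extension_plane X
  exact ⟨fun x => ⟨⟨projSquare (f x), projSquare_mem _⟩⟩,
    fun x y => (dist_projSquare_le _ _).trans (f_short x y),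
    fun p => congrArg ULift.up (Subtype.ext
      ((congrArg projSquare (f_S p)).trans (projSquare_of_mem p.2.1)))⟩

instance : CompleteSpace square.{u} :=
  have : CompleteSpace unitSquare := isCompact_unitSquare.isComplete.completeSpace_coe
  inferInstanceAs (CompleteSpace (ULift.{u} unitSquare))

theorem dist_map_le_of_dist_map_mk_le {P : Set Cell} {X : SquaMS.{u}} {Y : Type*}
    [PseudoMetricSpace Y] {f : Tensor P X → Y} (two : ∀ s t, dist (f s) (f t) ≤ 2)
    (third : ∀ m x y, dist (f (Tensor.mk (m, x))) (f (Tensor.mk (m, y))) ≤ 1 / 3 * dist x y)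
    (s t : Tensor P X) : dist (f s) (f t) ≤ dist s t := by
  induction s using Quot.ind with
  | mk a => induction t using Quot.ind with
    | mk b =>
      refine dist_le_pathDist (fun a => f (Tensor.mk a)) (fun a b => ?_) a b
      unfold stepScore
      split_ifs with same_point same_cell
      · rw [same_point, dist_self]
      · obtain ⟨m, x⟩ := a
        obtain ⟨n, y⟩ := b
        obtain rfl : m = n := same_cell
        exact third m x y
      · exact two _ _

/-- The morphism `M ⊗ U₀ ⟶ U₀`, `m ⊗ z ↦ shrink m + z / 3`, the restriction of `α_N`. It makes `U₀`
an algebra of which `(𝕊, τ)` is a subalgebra. -/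
noncomputable def alphaM : tensorM.obj square.{u} ⟶ square.{u} where
  toFun := Quot.lift
    (fun a : M × square.{u} =>
      ⟨⟨contraction a.1 a.2.down.1, contraction_mem a.1 a.2.down.2⟩⟩) (by
    rintro ⟨m, _⟩ ⟨n, _⟩ ⟨p, q, rfl, rfl, h⟩
    exact congrArg ULift.up (Subtype.ext (contraction_eq_of_glued h)))
  short := dist_map_le_of_dist_map_mk_le (fun _ _ => square.dist_le_two _ _)
    fun m x y => (dist_contraction m x.down.1 y.down.1).le
  map_S p := congrArg ULift.up (Subtype.ext (contraction_localPoint p))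

theorem isCorecursive_square :
    IsCorecursive (F := tensorM.{u}) ⟨square.{u}, alphaM.{u}⟩ :=
  have : CompleteSpace square.{u} := inferInstance
  isCorecursive_of_lipschitzWith_map
    (by rw [← NNReal.coe_lt_coe]; norm_num) lipschitzWith_tensorM_map
    fun X => nonempty_hom_square X.V

end square

section carpet

theorem subset_carpetSet_of_subset_hutchinson {A : Set Plane} (hU : A ⊆ unitSquare)
    (hA : A ⊆ hutchinson A) : A ⊆ carpetSet := by
  rw [existsUnique_isCarpet.unique isCarpet_carpetSet isCarpet_iInter_stage]
  refine Set.subset_iInter fun k => ?_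
  induction k with
  | zero => exact hU
  | succ k ih => exact hA.trans (hutchinson_mono ih)

/-- The inclusion `𝕊 ⟶ U₀` as a morphism of square metric spaces. -/
noncomputable def carpetInclusion : carpet.{u} ⟶ square.{u} where
  toFun x := ⟨⟨x.down.1, isCarpet_carpetSet.1 x.down.2⟩⟩
  short _ _ := le_rfl
  map_S _ := rfl

theorem tensorM_map_carpetInclusion_alphaM :
    tensorM.map carpetInclusion.{u} ≫ alphaM = tau ≫ carpetInclusion := by
  refine SquaMS.Hom.ext (funext fun s => ?_)
  induction s using Quot.ind with
  | mk a => rfl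

/-- The inclusion `(𝕊, τ) ⟶ (U₀, α_M)` as a morphism of algebras. -/
noncomputable def carpetAlgebraInclusion :
    (⟨carpet.{u}, tau.{u}⟩ : Endofunctor.Algebra tensorM.{u}) ⟶ ⟨square.{u}, alphaM.{u}⟩ where
  f := carpetInclusion
  h := tensorM_map_carpetInclusion_alphaM

instance : Mono carpetAlgebraInclusion.{u}.f :=
  mono_of_injective fun _ _ h =>
    ULift.down_injective (Subtype.ext (congrArg (fun z : square.{u} => z.down.1) h))

theorem mem_carpetSet_of_solution {B : SquaMS.{u}} {β : B ⟶ tensorM.obj B} {h : B ⟶ square.{u}}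
    (h_sol : h = β ≫ tensorM.map h ≫ alphaM) (b : B) : (h.toFun b).down.1 ∈ carpetSet := by
  refine subset_carpetSet_of_subset_hutchinson (A := Set.range fun b => (h.toFun b).down.1)
    (Set.range_subset_iff.2 fun b => (h.toFun b).down.2)
    (Set.range_subset_iff.2 fun b => ?_) ⟨b, rfl⟩
  obtain ⟨⟨m, c⟩, hβ⟩ := Quot.exists_rep (β.toFun b)
  refine mem_hutchinson.2 ⟨m, _, ⟨c, rfl⟩, ?_⟩
  calc contraction m (h.toFun c).down.1
    _ = (alphaM.toFun ((tensorM.map h).toFun (Tensor.mk (m, c)))).down.1 := rfl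
    _ = ((β ≫ tensorM.map h ≫ alphaM).toFun b).down.1 := by rw [Tensor.mk, hβ]; rfl
    _ = (h.toFun b).down.1 := by rw [← h_sol]

theorem exists_comp_carpetInclusion_eq {B : SquaMS.{u}} (h : B ⟶ square.{u})
    (h_mem : ∀ b, (h.toFun b).down.1 ∈ carpetSet) : ∃ k, k ≫ carpetInclusion = h := by
  have map_S (p : boundary) : (h.toFun (B.S p)).down.1 = p.1 := by
    rw [h.map_S p]; rfl
  exact ⟨⟨fun b => ⟨⟨(h.toFun b).down.1, h_mem b⟩⟩, h.short,
    fun p => ULift.down_injective (Subtype.ext (map_S p))⟩, rfl⟩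

theorem isCorecursive_carpet : IsCorecursive (F := tensorM.{u}) ⟨carpet.{u}, tau.{u}⟩ :=
  isCorecursive_square.of_mono carpetAlgebraInclusion fun _ h h_sol =>
    exists_comp_carpetInclusion_eq h (mem_carpetSet_of_solution h_sol)

end carpet

section inverse

theorem eq_zero_or_one_of_third_add_eq {i j : Fin 3} (hij : i ≠ j) {s t : ℝ}
    (hs : s ∈ Set.Icc 0 1) (ht : t ∈ Set.Icc 0 1)
    (h : ((i.val : ℝ) + s) / 3 = (j.val + t) / 3) : s = 0 ∨ s = 1 := by
  have add_one_le {i j : Fin 3} (hij : i < j) : (i.val : ℝ) + 1 ≤ j.val := by exact_mod_cast hij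
  obtain ⟨s_nonneg, s_le⟩ := hs
  obtain ⟨t_nonneg, t_le⟩ := ht
  rcases hij.lt_or_gt with hlt | hgt
  · exact Or.inr (by linarith [add_one_le hlt])
  · exact Or.inl (by linarith [add_one_le hgt])

theorem mem_boundary_of_contraction_eq {m n : Cell} (hmn : m ≠ n) {p q : Plane}
    (hp : p ∈ unitSquare) (hq : q ∈ unitSquare) (h : contraction m p = contraction n q) :
    p ∈ boundary := by
  have h_fst := congrArg WithLp.fst h
  have h_snd := congrArg WithLp.snd h
  rw [contraction_fst, contraction_fst] at h_fst
  rw [contraction_snd, contraction_snd] at h_snd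
  refine ⟨hp, ?_⟩
  by_cases hcol : m.1 = n.1
  · have hrow : m.2 ≠ n.2 := fun hrow => hmn (Prod.ext hcol hrow)
    exact Or.inr (Or.inr (eq_zero_or_one_of_third_add_eq hrow hp.2.2 hq.2.2 h_snd))
  · exact (eq_zero_or_one_of_third_add_eq hcol ⟨hp.1, hp.2.1⟩ ⟨hq.1, hq.2.1⟩ h_fst).imp_right
      Or.inl

theorem tauFun_injective : Injective tauFun.{u} := by
  intro s t hst
  induction s using Quot.ind with
  | mk a => induction t using Quot.ind with
    | mk b =>
      obtain ⟨m, x⟩ := a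
      obtain ⟨n, y⟩ := b
      have h : contraction m x.down.1 = contraction n y.down.1 :=
        congrArg (fun z : carpet.{u} => z.down.1) hst
      have hx := isCarpet_carpetSet.1 x.down.2
      have hy := isCarpet_carpetSet.1 y.down.2
      obtain rfl | hmn := eq_or_ne m n
      · rw [ULift.down_injective (Subtype.ext (contraction_injective _ h))]
      · have hmn' : m.1 ≠ n.1 := Subtype.coe_ne_coe.2 hmn
        exact mk_eq_of_contraction_eq (X := carpet.{u}) m n
          ⟨_, mem_boundary_of_contraction_eq hmn' hx hy h⟩
          ⟨_, mem_boundary_of_contraction_eq hmn'.symm hy hx h.symm⟩ h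

theorem tauFun_surjective : Surjective tauFun.{u} := by
  rintro ⟨⟨p, hp⟩⟩
  obtain ⟨m, q, hq, rfl⟩ := mem_hutchinson.1 (isCarpet_carpetSet.2.2.2.symm.subset hp)
  exact ⟨Tensor.mk (m, ⟨⟨q, hq⟩⟩), rfl⟩

/-- The distance of a point of the unit square to the two horizontal sides. -/
noncomputable def height (p : Plane) : ℝ := min p.snd (1 - p.snd)

theorem abs_height_sub_le (p q : Plane) : |height p - height q| ≤ |p.snd - q.snd| := by
  refine (abs_min_sub_min_le_max _ _ _ _).trans (max_le le_rfl (le_of_eq ?_))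
  rw [sub_sub_sub_cancel_left, abs_sub_comm]

/-- The first coordinate on `M ⊗ U₀`, increased on the cell to the right of the hole by the
distance to the horizontal sides of that cell. -/
noncomputable def detour (a : M × square.{u}) : ℝ :=
  (contraction a.1 a.2.down.1).fst + if a.1.1 = (2, 1) then height a.2.down.1 / 3 else 0

theorem detour_eq_of_glueRel (a b : M × square.{u}) (h : GlueRel M square.{u} a b) :
    detour a = detour b := by
  obtain ⟨⟨m, hm⟩, _⟩ := a
  obtain ⟨⟨n, hn⟩, _⟩ := b
  obtain ⟨p, q, rfl, rfl, h⟩ := h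
  have height_of_snd {p : Plane} (hp : p.snd = 0 ∨ p.snd = 1) : height p = 0 := by
    rcases hp with hp | hp <;> simp [height, hp]
  refine congrArg₂ (· + ·) (congrArg WithLp.fst (contraction_eq_of_glued h)) ?_
  change (if m = (2, 1) then height p.1 / 3 else 0) = if n = (2, 1) then height q.1 / 3 else 0
  dsimp only [Glued] at h
  obtain ⟨h_col, h_row, -⟩ | ⟨-, -, hp, hq, -⟩ := h
  · -- Horizontally, the cell `(2, 1)` could only be glued to the hole.
    have hm' : m ≠ (2, 1) := by rintro rfl; have := n.1.isLt; dsimp only at h_col; omega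
    have hn' : n ≠ (2, 1) := by
      rintro rfl
      exact hm (Prod.ext (Fin.ext (Nat.succ_injective h_col.symm)) h_row.symm)
    rw [if_neg hm', if_neg hn']
  · rw [height_of_snd (Or.inr hp), height_of_snd (Or.inl hq), zero_div, ite_self, ite_self]

theorem abs_detour_sub_le (m : M) (x y : square.{u}) :
    |detour (m, x) - detour (m, y)| ≤ 1 / 3 * dist x y := by
  have abs_ite_le : |if m.1 = (2, 1) then height x.down.1 - height y.down.1 else 0| ≤
      |x.down.1.snd - y.down.1.snd| := by
    split_ifs
    · exact abs_height_sub_le _ _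
    · exact abs_zero.trans_le (abs_nonneg _)
  calc |detour (m, x) - detour (m, y)|
    _ = |1 / 3 * ((x.down.1.fst - y.down.1.fst) +
          if m.1 = (2, 1) then height x.down.1 - height y.down.1 else 0)| := by
      simp only [detour, contraction_fst]
      split_ifs <;> ring_nf
    _ = 1 / 3 * |(x.down.1.fst - y.down.1.fst) +
          if m.1 = (2, 1) then height x.down.1 - height y.down.1 else 0| := by
      rw [abs_mul, abs_of_pos (by norm_num : (0 : ℝ) < 1 / 3)]
    _ ≤ 1 / 3 * (|x.down.1.fst - y.down.1.fst| + |x.down.1.snd - y.down.1.snd|) := by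
      gcongr
      exact (abs_add_le _ _).trans (add_le_add_right abs_ite_le _)
    _ = 1 / 3 * dist x y := congrArg _ (dist_plane _ _).symm

theorem detour_mem_Icc (a : M × square.{u}) : detour a ∈ Set.Icc 0 2 := by
  obtain ⟨fst_nonneg, fst_le, -⟩ := contraction_mem a.1 a.2.down.2
  obtain ⟨-, -, snd_nonneg, snd_le⟩ := a.2.down.2
  have height_nonneg : 0 ≤ height a.2.down.1 := le_min snd_nonneg (sub_nonneg.2 snd_le)
  have height_le : height a.2.down.1 ≤ 1 := (min_le_left _ _).trans snd_le
  unfold detour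
  split_ifs <;> constructor <;> linarith

theorem abs_detour_sub_le_dist_mk (a b : M × square.{u}) :
    |detour a - detour b| ≤ dist (Tensor.mk a) (Tensor.mk b) :=
  abs_sub_le_pathDist detour detour_eq_of_glueRel abs_detour_sub_le
    (fun a b => (Real.dist_le_of_mem_Icc (detour_mem_Icc a) (detour_mem_Icc b)).trans_eq
      (sub_zero 2)) a b

theorem vertical_midpoint_mem {a : ℝ} (ha : a = 0 ∨ a = 1) :
    (WithLp.toLp 1 (a, 1 / 2) : Plane) ∈ boundary :=
  vertical_mem ha (by norm_num) (by norm_num)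

/-- The midpoint of the left side of the central hole. -/
noncomputable def holeLeft (X : SquaMS.{u}) : Tensor M X :=
  Tensor.mk (⟨(0, 1), by simp [M]⟩, X.S ⟨_, vertical_midpoint_mem (Or.inr rfl)⟩)

/-- The midpoint of the right side of the central hole. -/
noncomputable def holeRight (X : SquaMS.{u}) : Tensor M X :=
  Tensor.mk (⟨(2, 1), by simp [M]⟩, X.S ⟨_, vertical_midpoint_mem (Or.inl rfl)⟩)

theorem half_le_dist_hole_square : 1 / 2 ≤ dist (holeLeft square.{u}) (holeRight square.{u}) := by
  refine le_trans ?_ (abs_detour_sub_le_dist_mk _ _)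
  have down_S (p : boundary) : (square.{u}.S p).down.1 = p.1 := rfl
  simp only [detour, contraction_fst, down_S, height]
  rw [if_neg (by decide), if_pos trivial]
  norm_num [abs_of_neg]

theorem half_le_dist_hole (X : SquaMS.{u}) : 1 / 2 ≤ dist (holeLeft X) (holeRight X) := by
  obtain ⟨h⟩ := nonempty_hom_square X
  have map_left : (tensorM.map h).toFun (holeLeft X) = holeLeft square :=
    congrArg (fun z => Tensor.mk (_, z)) (h.map_S _)
  have map_right : (tensorM.map h).toFun (holeRight X) = holeRight square :=
    congrArg (fun z => Tensor.mk (_, z)) (h.map_S _)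
  calc 1 / 2
    _ ≤ dist (holeLeft square.{u}) (holeRight square.{u}) := half_le_dist_hole_square
    _ = dist ((tensorM.map h).toFun (holeLeft X)) ((tensorM.map h).toFun (holeRight X)) := by
      exact congrArg₂ (dist (α := tensorM.obj square)) map_left.symm map_right.symm
    _ ≤ dist (holeLeft X) (holeRight X) := (tensorM.map h).short _ _

theorem dist_tauFun_hole :
    dist (tauFun (holeLeft carpet.{u})) (tauFun (holeRight carpet.{u})) = 1 / 3 := by
  change dist (contraction (0, 1) (WithLp.toLp 1 (1, 1 / 2)))
    (contraction (2, 1) (WithLp.toLp 1 (0, 1 / 2))) = _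
  rw [dist_plane]
  simp only [contraction_fst, contraction_snd]
  norm_num [abs_of_neg]

theorem not_short_of_leftInverse_tauFun {g : carpet.{u} → Tensor M carpet.{u}}
    (hg : LeftInverse g tauFun) : ¬ ∀ x y, dist (g x) (g y) ≤ dist x y := by
  intro g_short
  have h := g_short (tauFun (holeLeft carpet)) (tauFun (holeRight carpet))
  rw [hg, hg, dist_tauFun_hole] at h
  linarith [half_le_dist_hole carpet.{u}]

end inverse

end Sierpinski

theorem mainTheorem6 :
    Sierpinski.IsCorecursive (F := Sierpinski.tensorM.{u})
      ⟨Sierpinski.carpet.{u}, Sierpinski.tau.{u}⟩ ∧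
    ∃ g : Sierpinski.carpet.{u} → Sierpinski.tensorM.obj Sierpinski.carpet.{u},
      Function.LeftInverse g Sierpinski.tau.toFun ∧
      Function.RightInverse g Sierpinski.tau.toFun ∧
      ¬ ∀ x y : Sierpinski.carpet.{u}, dist (g x) (g y) ≤ dist x y := by
  have bijective : Function.Bijective Sierpinski.tauFun.{u} :=
    ⟨Sierpinski.tauFun_injective, Sierpinski.tauFun_surjective⟩
  obtain ⟨g, g_left, g_right⟩ := Function.bijective_iff_has_inverse.1 bijective
  exact ⟨Sierpinski.isCorecursive_carpet, g, g_left, g_right,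
    Sierpinski.not_short_of_leftInverse_tauFun g_left⟩
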